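/- All graphs are finite, simple and undirected. For a connected graph $G$, let $\delta(G)$ be its minimum degree, $\mathrm{diam}(G)$ its diameter (the maximum distance between two vertices), and $rc(G)$ its rainbow connection number: the minimum number of colours in an edge colouring of $G$ (adjacent edges may share a colour) for which every pair of vertices is joined by at least one path no two edges of which have the same colour. An interval graph (circular arc graph) is an intersection graph of intervals of the real line (arcs of a circle): each vertex is assigned a non-empty interval (arc), and distinct vertices are adjacent if and only if their intervals (arcs) intersect. A graph is AT-free if it has no asteroidal triple, i.e. no three distinct, pairwise non-adjacent vertices such that every two of them are joined by a path containing no neighbour of the third. A graph $G$ is a threshold graph if there are $w : V(G) \to \mathbb{R}$ and $t \in \mathbb{R}$ such that distinct vertices $u, v$ are adjacent if and only if $w(u) + w(v) \ge t$. A bipartite graph with parts $A, B$ is a chain graph if $A$ can be ordered as $a_1, \dots, a_k$ with $N(a_1) \subseteq N(a_2) \subseteq \dots \subseteq N(a_k)$. **Theorem.** Let $G$ be a connected graph with $\delta(G) \ge 2$. Then: 1. if $G$ is an interval graph, $\mathrm{diam}(G) \le rc(G) \le \mathrm{diam}(G) + 1$; 2. if $G$ is AT-free, $\mathrm{diam}(G)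 \le rc(G) \le \mathrm{diam}(G) + 3$; 3. if $G$ is a threshold graph, $\mathrm{diam}(G) \le rc(G) \le 3$; 4. if $G$ is a chain graph, $\mathrm{diam}(G) \le rc(G) \le 4$; 5. if $G$ is a circular arc graph, $\mathrm{diam}(G) \le rc(G) \le \mathrm{diam}(G) + 4$. Moreover, there exist a connected interval graph $G$ with $\delta(G) \ge 2$ and $rc(G) = \mathrm{diam}(G) + 1$, a connected threshold graph $G$ with $\delta(G) \ge 2$ and $rc(G) = 3$, a connected chain graph $G$ with $\delta(G) \ge 2$ and $rc(G) = 4$, and a connected AT-free graph $G$ with $\delta(G) \ge 2$ and $rc(G) = \mathrm{diam}(G) + 2$. -/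

import Mathlib

namespace SimpleGraph

/-- A rainbow path: a path in the edge-coloured graph no two of whose edges share a colour. -/
def IsRainbowPath {V : Type*} {G : SimpleGraph V} (c : G.edgeSet → ℕ) {u v : V}
    (p : G.Walk u v) : Prop :=
  p.IsPath ∧ ∀ e f : G.edgeSet, e.1 ∈ p.edges → f.1 ∈ p.edges → c e = c f → e = f

/-- A rainbow colouring: every pair of vertices is joined by at least one rainbow path. -/
def IsRainbowColouring {V : Type*} (G : SimpleGraph V) (c : G.edgeSet → ℕ) : Prop :=
  ∀ u v : V, ∃ p : G.Walk u v, IsRainbowPath c p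

/-- The rainbow connection number: the least number of colours used by a rainbow colouring.
It is `⊤` when there is no rainbow colouring (in particular for disconnected graphs). -/
noncomputable def rainbowConnectionNumber {V : Type*} (G : SimpleGraph V) : ℕ∞ :=
  ⨅ (c : G.edgeSet → ℕ) (_ : G.IsRainbowColouring c), (Set.range c).encard

/-- `G` is an intersection graph of the family `F`: its vertices can be mapped to members of `F`
so that distinct vertices are adjacent exactly when the two sets meet. -/
def IsIntersectionGraph {V α : Type*} (G : SimpleGraph V) (F : Set (Set α)) : Prop :=
  ∃ s : V → Set α, (∀ v, s v ∈ F) ∧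
    ∀ u v, u ≠ v → (G.Adj u v ↔ (s u ∩ s v).Nonempty)

/-- The non-empty intervals of the real line (open, closed or half-open, bounded or not). -/
def realIntervals : Set (Set ℝ) :=
  {I | I.Nonempty ∧ I.OrdConnected}

/-- The arcs of the circle `ℝ / ℤ`: the images of the non-empty intervals of the line. -/
def circleArcs : Set (Set UnitAddCircle) :=
  {A | ∃ I ∈ realIntervals, A = (fun x : ℝ => (x : UnitAddCircle)) '' I}

/-- Interval graphs. -/
def IsIntervalGraph {V : Type*} (G : SimpleGraph V) : Prop :=
  G.IsIntersectionGraph realIntervals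

/-- Circular arc graphs. -/
def IsCircularArcGraph {V : Type*} (G : SimpleGraph V) : Prop :=
  G.IsIntersectionGraph circleArcs

/-- There is a path from `x` to `y` that contains no neighbour of `z`. -/
def HasPathAvoidingNeighbours {V : Type*} (G : SimpleGraph V) (x y z : V) : Prop :=
  ∃ p : G.Walk x y, p.IsPath ∧ ∀ w ∈ p.support, ¬ G.Adj z w

/-- Asteroidal triples: three distinct, pairwise non-adjacent vertices such that any two of them
are joined by a path containing no neighbour of the third. -/
def IsAsteroidalTriple {V : Type*} (G : SimpleGraph V) (x y z : V) : Prop :=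
  (x ≠ y ∧ y ≠ z ∧ x ≠ z) ∧ (¬ G.Adj x y ∧ ¬ G.Adj y z ∧ ¬ G.Adj x z) ∧
    G.HasPathAvoidingNeighbours x y z ∧ G.HasPathAvoidingNeighbours y z x ∧
    G.HasPathAvoidingNeighbours x z y

/-- AT-free graphs. -/
def IsATFree {V : Type*} (G : SimpleGraph V) : Prop :=
  ∀ x y z : V, ¬ G.IsAsteroidalTriple x y z

/-- Threshold graphs. -/
def IsThresholdGraph {V : Type*} (G : SimpleGraph V) : Prop :=
  ∃ (w : V → ℝ) (t : ℝ), ∀ u v, u ≠ v → (G.Adj u v ↔ t ≤ w u + w v)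

/-- Chain graphs: bipartite graphs with parts `A`, `B` whose part `A` can be listed as
`a 0, …, a (k - 1)` with `N(a 0) ⊆ ⋯ ⊆ N(a (k - 1))`. -/
def IsChainGraph {V : Type*} (G : SimpleGraph V) : Prop :=
  ∃ A B : Set V, A ∪ B = Set.univ ∧ G.IsBipartiteWith A B ∧
    ∃ (k : ℕ) (a : Fin k → V), Function.Injective a ∧ Set.range a = A ∧
      ∀ i j, i ≤ j → G.neighborSet (a i) ⊆ G.neighborSet (a j)

end SimpleGraph

namespace SimpleGraph

variable {V : Type*} {G : SimpleGraph V}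

/-! The lower bound holds because a rainbow path has at most as many edges as there are colours. All
upper bounds come from one extension principle, `rainbowConnectionNumber_le_add_three`: if every
vertex has two neighbours and a dominating set `D` is rainbow connected inside itself with `k`
colours, then `k + 3` colours suffice for the graph. A dominating walk of length `k` is such a set.

It remains to find small dominating sets. A vertex of greatest weight dominates a threshold graph,
and a single edge dominates a chain graph. In an interval graph, take a shortest path from the
interval that ends first to the one that begins last; its inner vertices already dominate, which
saves two colours. An AT-free graph has a dominating pair, and a shortest path between the pair
dominates. A circular arc graph is either an interval graph, or its arcs greedily wind around the
circle in a dominating cycle. Half the length of that cycle bounds the diameter from below and, up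
to rounding, is the number of colours the cycle needs; very short windings are treated as walks.

The extremal examples rest on a pigeonhole argument: too many vertices attached to the same two
vertices force a repeated pair of colours. -/

/-! ### The diameter as a lower bound -/

theorem IsRainbowPath.length_le_encard {c : G.edgeSet → ℕ} {u v : V} {p : G.Walk u v}
    (hp : IsRainbowPath c p) : (p.length : ℕ∞) ≤ (Set.range c).encard := by
  classical
  let s : Set G.edgeSet := {e | e.1 ∈ p.edges}
  have hinj : Set.InjOn c s := fun e he f hf h => hp.2 e f he hf h
  have h1 : (c '' s).encard = s.encard := hinj.encard_image
  have h2 : (Subtype.val '' s).encard = s.encard := Subtype.val_injective.encard_image s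
  have h3 : Subtype.val '' s = (p.edges.toFinset : Set (Sym2 V)) := by
    ext e
    simp only [Set.mem_image, s, Set.mem_ofPred_eq, List.coe_toFinset]
    exact ⟨by rintro ⟨f, hf, rfl⟩; exact hf, fun h => ⟨⟨e, p.edges_subset_edgeSet h⟩, h, rfl⟩⟩
  have h4 : (p.edges.toFinset : Set (Sym2 V)).encard = p.length := by
    rw [Set.encard_coe_eq_coe_finsetCard, List.toFinset_card_of_nodup hp.1.edges_nodup,
      p.length_edges]
  rw [← h4, ← h3, h2, ← h1]
  exact Set.encard_le_encard (Set.image_subset_range _ _)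

theorem diam_le_rainbowConnectionNumber [Finite V] [Nonempty V] :
    (G.diam : ℕ∞) ≤ G.rainbowConnectionNumber := by
  obtain ⟨u, v, huv⟩ := G.exists_dist_eq_diam
  refine le_iInf₂ fun c hc => ?_
  obtain ⟨p, hp⟩ := hc u v
  rw [← huv]
  exact le_trans (by exact_mod_cast dist_le p) hp.length_le_encard

/-! ### Rainbow walks and dominating sets -/

/-- A walk whose edges receive pairwise different colours. -/
def Walk.IsRainbow (c : Sym2 V → ℕ) {u v : V} (p : G.Walk u v) : Prop :=
  (p.edges.map c).Nodup

theorem rainbowConnectionNumber_le {k : ℕ} (c : Sym2 V → ℕ)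
    (h : ∀ u v, ∃ p : G.Walk u v, p.IsRainbow c ∧ ∀ e ∈ p.edges, c e ≤ k) :
    G.rainbowConnectionNumber ≤ (k : ℕ∞) + 1 := by
  classical
  -- The hypothesis bounds colours only on the chosen walks, so the others are truncated at `k`; the
  -- colours `0, …, k` account for the `k + 1`.
  refine iInf₂_le_of_le (fun e => min (c e.1) k) ?_ ?_
  · intro u v
    obtain ⟨p, hp, hk⟩ := h u v
    refine ⟨p.bypass, p.bypass_isPath, fun e f he hf hef => ?_⟩
    have he' := p.edges_bypass_subset_edges he
    have hf' := p.edges_bypass_subset_edges hf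
    beta_reduce at hef
    rw [min_eq_left (hk _ he'), min_eq_left (hk _ hf')] at hef
    exact Subtype.ext (List.inj_on_of_nodup_map hp he' hf' hef)
  · have : Set.range (fun e : G.edgeSet => min (c e.1) k) ⊆ (Finset.range (k + 1) : Set ℕ) := by
      rintro _ ⟨e, rfl⟩
      simp only [Finset.coe_range, Set.mem_Iio]
      omega
    refine (Set.encard_le_encard this).trans ?_
    rw [Set.encard_coe_eq_coe_finsetCard, Finset.card_range]
    simp

/-- `D` is joined by rainbow walks inside `D` that use only colours less than `k`. -/
def RainbowOn (G : SimpleGraph V) (D : Set V) (c : Sym2 V → ℕ) (k : ℕ) : Prop :=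
  ∀ u ∈ D, ∀ v ∈ D, ∃ p : G.Walk u v, (∀ w ∈ p.support, w ∈ D) ∧ p.IsRainbow c ∧
    ∀ e ∈ p.edges, c e < k

def Dominates (G : SimpleGraph V) (D : Set V) : Prop :=
  ∀ v ∉ D, ∃ d ∈ D, G.Adj v d

theorem exists_maximal_independent [Finite V] (U : Set V) :
    ∃ X ⊆ U, (∀ x ∈ X, ∀ y ∈ X, ¬ G.Adj x y) ∧ ∀ y ∈ U, y ∉ X → ∃ x ∈ X, G.Adj y x := by
  let F : Set (Set V) := {X | X ⊆ U ∧ ∀ x ∈ X, ∀ y ∈ X, ¬ G.Adj x y}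
  obtain ⟨X, hX⟩ := (Set.toFinite F).exists_maximal ⟨∅, by simp [F]⟩
  refine ⟨X, hX.prop.1, hX.prop.2, fun y hy hyX => ?_⟩
  by_contra! hcon
  have hF : insert y X ∈ F := by
    refine ⟨Set.insert_subset hy hX.prop.1, ?_⟩
    rintro a (rfl | ha) b (rfl | hb)
    · exact G.loopless.irrefl _
    · exact hcon b hb
    · exact fun h => hcon a ha h.symm
    · exact hX.prop.2 a ha b hb
  exact hyX (hX.le_of_ge hF (Set.subset_insert y X) (Set.mem_insert y X))

/-! ### Extending a rainbow colouring from a dominating set -/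

section Colouring

variable {D : Set V} {c : Sym2 V → ℕ}

/-- `v` is joined to `D` by a rainbow walk with colours in `P`. -/
def RainbowRoute (G : SimpleGraph V) (D : Set V) (c : Sym2 V → ℕ) (v : V) (P : Set ℕ) : Prop :=
  ∃ d ∈ D, ∃ q : G.Walk v d, q.IsRainbow c ∧ ∀ e ∈ q.edges, c e ∈ P

theorem RainbowRoute.of_adj {v d : V} {P : Set ℕ} (hd : d ∈ D) (h : G.Adj v d)
    (hP : c s(v, d) ∈ P) : G.RainbowRoute D c v P :=
  ⟨d, hd, h.toWalk, by simp [Walk.IsRainbow], by simpa using hP⟩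

theorem RainbowRoute.of_adj_adj {v x d : V} {P : Set ℕ} (hd : d ∈ D) (h : G.Adj v x)
    (h' : G.Adj x d) (hP : c s(v, x) ∈ P) (hP' : c s(x, d) ∈ P) (hne : c s(v, x) ≠ c s(x, d)) :
    G.RainbowRoute D c v P :=
  ⟨d, hd, .cons h h'.toWalk, by simp [Walk.IsRainbow, hne], by simpa using ⟨hP, hP'⟩⟩

theorem RainbowRoute.exists_walk {k : ℕ} (hD : G.RainbowOn D c k) {u v : V} {P Q : Set ℕ}
    (hu : G.RainbowRoute D c u P) (hv : G.RainbowRoute D c v Q) (hPQ : Disjoint P Q)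
    (hP : P ⊆ Set.Icc k (k + 2)) (hQ : Q ⊆ Set.Icc k (k + 2)) :
    ∃ p : G.Walk u v, p.IsRainbow c ∧ ∀ e ∈ p.edges, c e ≤ k + 2 := by
  obtain ⟨d, hd, p, hp, hpP⟩ := hu
  obtain ⟨d', hd', q, hq, hqQ⟩ := hv
  obtain ⟨w, -, hw, hwk⟩ := hD d hd d' hd'
  refine ⟨(p.append w).append q.reverse, ?_, ?_⟩
  · simp only [Walk.IsRainbow, Walk.edges_append, Walk.edges_reverse, List.map_append,
      List.map_reverse]
    rw [List.nodup_append, List.nodup_append]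
    refine ⟨⟨hp, hw, ?_⟩, List.nodup_reverse.2 hq, ?_⟩
    · simp only [List.mem_map]
      rintro _ ⟨e, he, rfl⟩ _ ⟨f, hf, rfl⟩
      have := (hP (hpP e he)).1
      have := hwk f hf
      omega
    · simp only [List.mem_append, List.mem_map, List.mem_reverse]
      rintro _ (⟨e, he, rfl⟩ | ⟨e, he, rfl⟩) _ ⟨f, hf, rfl⟩
      · intro h
        exact Set.disjoint_left.1 hPQ (hpP e he) (h ▸ hqQ f hf)
      · have := hwk e he
        have := (hQ (hqQ f hf)).1
        omega
  · simp only [Walk.edges_append, Walk.edges_reverse, List.mem_append, List.mem_reverse]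
    rintro e ((he | he) | he)
    · exact (hP (hpP e he)).2
    · exact (hwk e he).le.trans (by omega)
    · exact (hQ (hqQ e he)).2

end Colouring

/-- A rainbow colouring of a dominating set extends to the graph at the cost of three colours. -/
theorem rainbowConnectionNumber_le_add_three [Finite V] {D : Set V} {c : Sym2 V → ℕ} {k : ℕ}
    (hdeg : ∀ v, ∃ a b, a ≠ b ∧ G.Adj v a ∧ G.Adj v b) (hdom : G.Dominates D)
    (hD : G.RainbowOn D c k) : G.rainbowConnectionNumber ≤ (k : ℕ∞) + 3 := by
  classical
  obtain ⟨X, hXD, hXind, hXmax⟩ := G.exists_maximal_independent Dᶜ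
  choose! f hfD hf using hdom
  -- Edges inside `D` keep `c` and edges outside `D` get `k + 2`. Edges to `D` get `k` from `X` and
  -- `k + 1` from the rest. The exception is a vertex with all its neighbours in `D`: its edge to `f
  -- x` gets `k + 1`, and minimum degree two leaves it another edge of colour `k`.
  let col : Sym2 V → ℕ := fun e =>
    if ∀ w ∈ e, w ∈ D then c e
    else if ∃ w ∈ e, w ∈ D then
      if (∃ y ∈ e, y ∉ D ∧ y ∉ X) ∨ (∃ x ∉ D, (∀ y, G.Adj x y → y ∈ D) ∧ e = s(x, f x)) then k + 1
      else k
    else k + 2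
  have colD : ∀ e, (∀ w ∈ e, w ∈ D) → col e = c e := fun e he => if_pos he
  have colO : ∀ a b, a ∉ D → b ∉ D → col s(a, b) = k + 2 := fun a b ha hb => by
    simp [col, ha, hb]
  have colY : ∀ y d, y ∉ D → y ∉ X → d ∈ D → col s(y, d) = k + 1 := fun y d hy hyX hd => by
    simp [col, hy, hyX, hd]
  have colI : ∀ x, x ∉ D → (∀ y, G.Adj x y → y ∈ D) → col s(x, f x) = k + 1 := fun x hx hxi => by
    have h1 : ¬ ∀ w ∈ s(x, f x), w ∈ D := fun h => hx (h x (by simp))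
    have h2 : ∃ w ∈ s(x, f x), w ∈ D := ⟨f x, by simp, hfD x hx⟩
    simp only [col]
    rw [if_neg h1, if_pos h2, if_pos (Or.inr ⟨x, hx, hxi, rfl⟩)]
  have colX : ∀ x d, x ∉ D → x ∈ X → d ∈ D → ((∀ y, G.Adj x y → y ∈ D) → d ≠ f x) →
      col s(x, d) = k := fun x d hx hxX hd hne => by
    have h1 : ¬ ∀ w ∈ s(x, d), w ∈ D := fun h => hx (h x (by simp))
    have h2 : ∃ w ∈ s(x, d), w ∈ D := ⟨d, by simp, hd⟩
    simp only [col]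
    rw [if_neg h1, if_pos h2, if_neg]
    rintro (⟨y, hy, hyD, hyX⟩ | ⟨z, hz, hzi, hzd⟩)
    · rcases Sym2.mem_iff.1 hy with rfl | rfl
      · exact hyX hxX
      · exact hyD hd
    · rcases Sym2.eq_iff.1 hzd with ⟨rfl, h⟩ | ⟨-, rfl⟩
      · exact hne hzi h
      · exact hz hd
  have hD' : G.RainbowOn D col k := by
    intro u hu v hv
    obtain ⟨p, hpD, hp, hpk⟩ := hD u hu v hv
    have he : ∀ e ∈ p.edges, col e = c e := fun e he => colD e fun w hw =>
      hpD w (p.mem_support_of_mem_edges he hw)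
    refine ⟨p, hpD, ?_, fun e hep => (he e hep).symm ▸ hpk e hep⟩
    rw [Walk.IsRainbow, List.map_congr_left he]
    exact hp
  -- Each vertex outside `D` has two routes into `D` with disjoint colour sets, so any two vertices
  -- can pick routes that share no colour.
  have routes : ∀ v, G.RainbowRoute D col v ∅ ∨
      (G.RainbowRoute D col v {k} ∧ G.RainbowRoute D col v {k + 1, k + 2}) ∨
      (G.RainbowRoute D col v {k + 1} ∧ G.RainbowRoute D col v {k, k + 2}) := by
    intro v
    by_cases hv : v ∈ D
    · exact Or.inl ⟨v, hv, .nil, by simp [Walk.IsRainbow], by simp⟩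
    by_cases hvX : v ∈ X
    · refine Or.inr (Or.inl ?_)
      by_cases hvi : ∀ y, G.Adj v y → y ∈ D
      · obtain ⟨d, hd, hdf⟩ : ∃ d, G.Adj v d ∧ d ≠ f v := by
          obtain ⟨a, b, hab, ha, hb⟩ := hdeg v
          by_cases h : a = f v
          · exact ⟨b, hb, fun h' => hab (h.trans h'.symm)⟩
          · exact ⟨a, ha, h⟩
        exact ⟨.of_adj (hvi d hd) hd (by simp [colX v d hv hvX (hvi d hd) fun _ => hdf]),
          .of_adj (hfD v hv) (hf v hv) (by simp [colI v hv hvi])⟩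
      · have h1 := colX v (f v) hv hvX (hfD v hv) (fun h => absurd h hvi)
        push Not at hvi
        obtain ⟨y, hvy, hy⟩ := hvi
        have hyX : y ∉ X := fun h => hXind v hvX y h hvy
        have h2 := colO v y hv hy
        have h3 := colY y (f y) hy hyX (hfD y hy)
        exact ⟨.of_adj (hfD v hv) (hf v hv) (by simp [h1]),
          .of_adj_adj (hfD y hy) hvy (hf y hy) (by simp [h2]) (by simp [h3]) (by omega)⟩
    · obtain ⟨x, hx, hvx⟩ := hXmax v hv hvX
      have hxD : x ∉ D := hXD hx
      have h1 := colY v (f v) hv hvX (hfD v hv)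
      have h2 := colO v x hv hxD
      have h3 := colX x (f x) hxD hx (hfD x hxD) (fun h => absurd (h v hvx.symm) hv)
      exact Or.inr (Or.inr ⟨.of_adj (hfD v hv) (hf v hv) (by simp [h1]),
        .of_adj_adj (hfD x hxD) hvx (hf x hxD) (by simp [h2]) (by simp [h3]) (by omega)⟩)
  have key : ∀ u v, ∃ p : G.Walk u v, p.IsRainbow col ∧ ∀ e ∈ p.edges, col e ≤ k + 2 := by
    intro u v
    rcases routes u with hu | ⟨hu, hu'⟩ | ⟨hu, hu'⟩ <;>
    rcases routes v with hv | ⟨hv, hv'⟩ | ⟨hv, hv'⟩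
    · refine hu.exists_walk hD' hv ?_ ?_ ?_ <;> grind
    · refine hu.exists_walk hD' hv ?_ ?_ ?_ <;> grind
    · refine hu.exists_walk hD' hv ?_ ?_ ?_ <;> grind
    · refine hu.exists_walk hD' hv ?_ ?_ ?_ <;> grind
    · refine hu.exists_walk hD' hv' ?_ ?_ ?_ <;> grind
    · refine hu.exists_walk hD' hv ?_ ?_ ?_ <;> grind
    · refine hu.exists_walk hD' hv ?_ ?_ ?_ <;> grind
    · refine hu.exists_walk hD' hv ?_ ?_ ?_ <;> grind
    · refine hu.exists_walk hD' hv' ?_ ?_ ?_ <;> grind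
  refine (rainbowConnectionNumber_le col key).trans ?_
  norm_cast

/-- Colouring an edge by its first position in `p` separates the edges of `p`. Going back to the
start and out again, then removing repetitions, uses each edge at most once, so `p` need not be a
path. -/
theorem Walk.rainbowOn_support [DecidableEq V] {u v : V} (p : G.Walk u v) :
    G.RainbowOn {w | w ∈ p.support} (fun e => p.edges.idxOf e) p.length := by
  intro a ha b hb
  let q : G.Walk a b := ((p.takeUntil a ha).reverse.append (p.takeUntil b hb)).bypass
  have hq : ∀ e ∈ q.edges, e ∈ p.edges := by
    intro e he
    have := Walk.edges_bypass_subset_edges _ he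
    simp only [Walk.edges_append, Walk.edges_reverse, List.mem_append, List.mem_reverse] at this
    exact this.elim (fun h => p.edges_takeUntil_subset_edges ha h)
      fun h => p.edges_takeUntil_subset_edges hb h
  refine ⟨q, ?_, ?_, fun e he => ?_⟩
  · intro w hw
    have := Walk.support_bypass_subset_support _ hw
    rw [Walk.mem_support_append_iff, Walk.support_reverse, List.mem_reverse] at this
    exact this.elim (fun h => p.support_takeUntil_subset_support ha h)
      fun h => p.support_takeUntil_subset_support hb h
  · refine List.Nodup.map_on (fun e he f _ h => ?_) (Walk.bypass_isPath _).edges_nodup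
    exact (List.idxOf_inj (hq e he)).1 h
  · rw [← p.length_edges]
    exact List.idxOf_lt_length_of_mem (hq e he)

theorem rainbowConnectionNumber_le_of_dominating_walk [Finite V]
    (hdeg : ∀ v, ∃ a b, a ≠ b ∧ G.Adj v a ∧ G.Adj v b) {u v : V} (p : G.Walk u v)
    (hp : G.Dominates {w | w ∈ p.support}) :
    G.rainbowConnectionNumber ≤ (p.length : ℕ∞) + 3 := by
  classical
  exact rainbowConnectionNumber_le_add_three hdeg hp p.rainbowOn_support

theorem exists_two_adj_of_two_le_minDegree [Fintype V] [DecidableRel G.Adj]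
    (h : 2 ≤ G.minDegree) (v : V) : ∃ a b, a ≠ b ∧ G.Adj v a ∧ G.Adj v b := by
  have h2 : 1 < (G.neighborFinset v).card := h.trans (G.minDegree_le_degree v)
  obtain ⟨a, ha, b, hb, hab⟩ := Finset.one_lt_card.1 h2
  exact ⟨a, b, hab, by simpa using ha, by simpa using hb⟩

/-! ### Threshold graphs and chain graphs -/

theorem IsThresholdGraph.rainbowConnectionNumber_le [Finite V] [Nonempty V]
    (hdeg : ∀ v, ∃ a b, a ≠ b ∧ G.Adj v a ∧ G.Adj v b) (h : G.IsThresholdGraph) :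
    G.rainbowConnectionNumber ≤ 3 := by
  obtain ⟨w, t, h⟩ := h
  obtain ⟨u, hu⟩ := Finite.exists_max w
  have := rainbowConnectionNumber_le_of_dominating_walk hdeg (Walk.nil : G.Walk u u) ?_
  · simpa using this
  · intro v hv
    obtain ⟨a, -, -, ha, -⟩ := hdeg v
    refine ⟨u, by simp, (h v u (by simpa using hv)).2 ?_⟩
    linarith [(h v a ha.ne).1 ha, hu a]

/-- A neighbour `b` of the first `a` is adjacent to all of `A`. Since no vertex is isolated, the
last `a` is adjacent to all of `B`. These two vertices form a dominating edge. -/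
theorem IsChainGraph.rainbowConnectionNumber_le [Finite V] [Nonempty V]
    (hdeg : ∀ v, ∃ a b, a ≠ b ∧ G.Adj v a ∧ G.Adj v b) (h : G.IsChainGraph) :
    G.rainbowConnectionNumber ≤ 4 := by
  obtain ⟨A, B, hAB, hbip, k, a, -, hA, hmono⟩ := h
  have hk : 0 < k := by
    rcases Nat.eq_zero_or_pos k with rfl | hk
    · obtain ⟨v⟩ := ‹Nonempty V›
      obtain ⟨x, -, -, hx, -⟩ := hdeg v
      have hA' : A = ∅ := by rw [← hA]; exact Set.range_eq_empty a
      rcases hbip.mem_of_adj hx with h | h <;> simp [hA'] at h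
    · exact hk
  let z : Fin k := ⟨0, hk⟩
  let l : Fin k := ⟨k - 1, by omega⟩
  obtain ⟨b, -, -, hb, -⟩ := hdeg (a z)
  have hbA : ∀ x ∈ A, G.Adj x b := by
    rw [← hA]
    rintro _ ⟨i, rfl⟩
    exact hmono z i (Fin.mk_le_of_le_val (Nat.zero_le _)) hb
  have hl : ∀ y ∈ B, G.Adj y (a l) := by
    intro y hy
    obtain ⟨x, -, -, hx, -⟩ := hdeg y
    have hxA : x ∈ A := hbip.symm.mem_of_mem_adj hy hx
    rw [← hA] at hxA
    obtain ⟨i, rfl⟩ := hxA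
    exact (hmono i l (Fin.le_def.2 (by have := i.2; simp only [l]; omega)) hx.symm : G.Adj _ _).symm
  have hlb : G.Adj (a l) b := hbA _ (hA ▸ Set.mem_range_self l)
  have := rainbowConnectionNumber_le_of_dominating_walk hdeg hlb.toWalk ?_
  · refine this.trans ?_
    simp only [Walk.length_cons, Walk.length_nil]
    norm_num
  · intro v _
    rcases (hAB ▸ Set.mem_univ v : v ∈ A ∪ B) with hv | hv
    · exact ⟨b, by simp, hbA v hv⟩
    · exact ⟨a l, by simp, hl v hv⟩

/-! ### Interval graphs -/

theorem rainbowConnectionNumber_le_one_of_complete (h : ∀ u v, u ≠ v → G.Adj u v) :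
    G.rainbowConnectionNumber ≤ 1 := by
  have := rainbowConnectionNumber_le (G := G) (k := 0) (fun _ => 0) fun u v => by
    by_cases huv : u = v
    · subst huv
      exact ⟨.nil, by simp [Walk.IsRainbow], by simp⟩
    · exact ⟨(h u v huv).toWalk, by simp [Walk.IsRainbow], by simp⟩
  simpa using this

/-- A union of intervals along a walk of an intersection graph is an interval. -/
theorem Walk.ordConnected_iUnion {s : V → Set ℝ} (hs : ∀ v, (s v).OrdConnected)
    (hadj : ∀ u v, G.Adj u v → (s u ∩ s v).Nonempty) {u v : V}
    (p : G.Walk u v) : {x | ∃ w ∈ p.support, x ∈ s w}.OrdConnected := by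
  induction p with
  | nil => simpa using hs _
  | @cons a b c hab q ih =>
    obtain ⟨z, hz, hz'⟩ := hadj _ _ hab
    have : {x | ∃ w ∈ (Walk.cons hab q).support, x ∈ s w} =
        s a ∪ {x | ∃ w ∈ q.support, x ∈ s w} := by
      ext x
      simp
    rw [this, ← isPreconnected_iff_ordConnected]
    exact IsPreconnected.union z hz ⟨b, q.start_mem_support, hz'⟩ (hs a).isPreconnected
      ih.isPreconnected

theorem IsIntervalGraph.rainbowConnectionNumber_le [Finite V] (hG : G.Connected)
    (hdeg : ∀ v, ∃ a b, a ≠ b ∧ G.Adj v a ∧ G.Adj v b) (h : G.IsIntervalGraph) :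
    G.rainbowConnectionNumber ≤ (G.diam : ℕ∞) + 1 := by
  obtain ⟨s, hs, hadj⟩ := h
  have := hG.nonempty
  have hoc : ∀ v, (s v).OrdConnected := fun v => (hs v).2
  -- Lower and upper closures compare end points without distinguishing open, closed or unbounded
  -- intervals; upper sets are ordered by reverse inclusion, hence the maximum for `v`.
  obtain ⟨u, hu⟩ := Finite.exists_min fun v => lowerClosure (s v)
  obtain ⟨v, hv⟩ := Finite.exists_max fun v => upperClosure (s v)
  have hu' : ∀ w, ∀ x ∈ s u, ∃ y ∈ s w, x ≤ y := fun w x hx => hu w (subset_lowerClosure hx)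
  have hv' : ∀ w, ∀ x ∈ s v, ∃ y ∈ s w, y ≤ x := fun w x hx => hv w (subset_upperClosure hx)
  by_cases hcap : (s u ∩ s v).Nonempty
  · obtain ⟨x, hxu, hxv⟩ := hcap
    have hx : ∀ w, x ∈ s w := by
      intro w
      obtain ⟨y, hy, hxy⟩ := hu' w x hxu
      obtain ⟨z, hz, hzx⟩ := hv' w x hxv
      exact (hoc w).out hz hy ⟨hzx, hxy⟩
    refine (rainbowConnectionNumber_le_one_of_complete fun a b hab =>
      (hadj a b hab).2 ⟨x, hx a, hx b⟩).trans ?_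
    exact le_add_self
  · have huv : u ≠ v := by
      rintro rfl
      exact hcap (by simpa using (hs u).1)
    obtain ⟨p, hp⟩ := hG.exists_walk_length_eq_dist u v
    have hpd : p.length ≤ G.diam := hp ▸ dist_le_diam (connected_iff_ediam_ne_top.1 hG)
    cases p with
    | nil => exact absurd rfl huv
    | @cons _ a _ hua q =>
      have hav : a ≠ v := by
        rintro rfl
        exact hcap ((hadj _ _ huv).1 hua)
      obtain ⟨b, r, hbv, hqr⟩ : ∃ (b : V) (r : G.Walk a b) (hbv : G.Adj b v),
          q.length = r.length + 1 := by
        have hq : ¬ q.Nil := Walk.not_nil_of_ne hav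
        exact ⟨_, q.dropLast, q.adj_penultimate hq, (q.length_dropLast_add_one hq).symm⟩
      -- The inner walk `r` is two shorter than the shortest path, which turns `+ 3` into `+ 1`.
      have hdom := rainbowConnectionNumber_le_of_dominating_walk hdeg r ?_
      · refine hdom.trans ?_
        rw [Walk.length_cons] at hpd
        norm_cast
        omega
      · intro w hw
        by_contra! hcon
        obtain ⟨x, hxu, hxa⟩ := (hadj _ _ hua.ne).1 hua
        obtain ⟨y, hyb, hyv⟩ := (hadj _ _ hbv.ne).1 hbv
        obtain ⟨x', hx', hxx'⟩ := hu' w x hxu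
        obtain ⟨y', hy', hyy'⟩ := hv' w y hyv
        have hdisj : ∀ z ∈ s w, ∀ d ∈ r.support, z ∉ s d := fun z hz d hd hzd =>
          hcon d hd ((hadj w d (fun h => hw (h ▸ hd))).2 ⟨z, hz, hzd⟩)
        have hU := r.ordConnected_iUnion hoc (fun a b hab => (hadj a b hab.ne).1 hab)
        have hxU : x ∈ {x | ∃ w ∈ r.support, x ∈ s w} := ⟨a, r.start_mem_support, hxa⟩
        have hyU : y ∈ {x | ∃ w ∈ r.support, x ∈ s w} := ⟨b, r.end_mem_support, hyb⟩
        have hnot : ∀ z ∈ s w, z ∉ {x | ∃ w ∈ r.support, x ∈ s w} := by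
          rintro z hz ⟨d, hd, hzd⟩
          exact hdisj z hz d hd hzd
        have hxw : x ∉ s w := fun h => hnot x h hxU
        have hyw : y ∉ s w := fun h => hnot y h hyU
        -- An interval missing the union along `r` must lie strictly between `x` and `y`. The union
        -- is an interval containing both, a contradiction.
        have h1 : ∀ z ∈ s w, x < z := fun z hz => by
          by_contra! hzx
          exact hxw ((hoc w).out hz hx' ⟨hzx, hxx'⟩)
        have h2 : ∀ z ∈ s w, z < y := fun z hz => by
          by_contra! hzx
          exact hyw ((hoc w).out hy' hz ⟨hyy', hzx⟩)
        exact hnot x' hx' (hU.out hxU hyU ⟨hxx', (h2 x' hx').le⟩)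

/-! ### AT-free graphs: dominating pairs -/

/-- `a` and `b` are joined by a walk inside `A`. -/
def ReachableIn (G : SimpleGraph V) (A : Set V) (a b : V) : Prop :=
  ∃ p : G.Walk a b, ∀ w ∈ p.support, w ∈ A

namespace ReachableIn

variable {A B : Set V} {a b d : V}

theorem refl (ha : a ∈ A) : G.ReachableIn A a a := ⟨.nil, by simpa using ha⟩

theorem symm (h : G.ReachableIn A a b) : G.ReachableIn A b a :=
  h.elim fun p hp => ⟨p.reverse, by simpa using hp⟩

theorem trans (h : G.ReachableIn A a b) (h' : G.ReachableIn A b d) : G.ReachableIn A a d := by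
  obtain ⟨p, hp⟩ := h
  obtain ⟨q, hq⟩ := h'
  refine ⟨p.append q, fun w hw => ?_⟩
  rw [Walk.mem_support_append_iff] at hw
  exact hw.elim (hp w) (hq w)

theorem mono (h : G.ReachableIn A a b) (hAB : A ⊆ B) : G.ReachableIn B a b :=
  h.elim fun p hp => ⟨p, fun w hw => hAB (hp w hw)⟩

theorem left_mem (h : G.ReachableIn A a b) : a ∈ A :=
  h.elim fun p hp => hp a p.start_mem_support

theorem right_mem (h : G.ReachableIn A a b) : b ∈ A := h.symm.left_mem

theorem of_adj (h : G.Adj a b) (ha : a ∈ A) (hb : b ∈ A) : G.ReachableIn A a b :=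
  ⟨h.toWalk, by simpa using ⟨ha, hb⟩⟩

/-- A set closed under adjacency inside `A` contains everything reachable from it; the walk may
be taken to stay in the set. -/
theorem inter_of_closed {T : Set V} (h : G.ReachableIn A a b) (ha : a ∈ T)
    (hT : ∀ x ∈ T, ∀ y ∈ A, G.Adj x y → y ∈ T) : G.ReachableIn (A ∩ T) a b := by
  obtain ⟨p, hp⟩ := h
  induction p with
  | nil => exact refl ⟨hp _ (by simp), ha⟩
  | @cons u v w huv q ih =>
    have hv : v ∈ A := hp v (by simp)
    have hvT := hT u ha v hv huv
    exact (of_adj (A := A ∩ T) huv ⟨hp u (by simp), ha⟩ ⟨hv, hvT⟩).trans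
      (ih hvT fun w hw => hp w (by simp [hw]))

end ReachableIn

/-- The vertices different from `v` and not adjacent to `v`. -/
def nonneighbors (G : SimpleGraph V) (v : V) : Set V := {w | w ≠ v ∧ ¬ G.Adj v w}

theorem mem_nonneighbors_comm {v w : V} : w ∈ G.nonneighbors v ↔ v ∈ G.nonneighbors w := by
  simp [nonneighbors, ne_comm, G.adj_comm]

theorem IsATFree.false_of_reachableIn (h : G.IsATFree) {x y z : V}
    (hxy : G.ReachableIn (G.nonneighbors z) x y) (hyz : G.ReachableIn (G.nonneighbors x) y z)
    (hxz : G.ReachableIn (G.nonneighbors y) x z) : False := by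
  classical
  have key : ∀ {a b c : V}, G.ReachableIn (G.nonneighbors c) a b →
      G.HasPathAvoidingNeighbours a b c := by
    rintro a b c ⟨p, hp⟩
    exact ⟨p.bypass, p.bypass_isPath, fun w hw =>
      (hp w (p.support_bypass_subset_support hw)).2⟩
  have h1 := hxy.left_mem
  have h2 := hxy.right_mem
  have h3 := hyz.left_mem
  exact h x y z ⟨⟨h3.1.symm, h2.1, h1.1⟩, ⟨h3.2, fun h => h2.2 h.symm, fun h => h1.2 h.symm⟩,
    key hxy, key hyz, key hxz⟩

/-- In an AT-free graph every non-empty vertex set `X` contains a vertex `x` such that no two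
vertices `u`, `v` are both joined to `x` inside `X` by walks missing the neighbourhood of the
other one. -/
theorem IsATFree.exists_admissible [Finite V] (h : G.IsATFree) (X : Set V) (hX : X.Nonempty) :
    ∃ x ∈ X, ∀ u v, G.ReachableIn (X ∩ G.nonneighbors v) x u →
      ¬ G.ReachableIn (X ∩ G.nonneighbors u) x v := by
  induction hn : X.ncard using Nat.strong_induction_on generalizing X with
  | _ n ih =>
  subst hn
  by_cases hall : ∀ x ∈ X, X ∩ G.nonneighbors x = ∅
  · obtain ⟨x, hx⟩ := hX
    refine ⟨x, hx, fun u v hu hv => ?_⟩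
    have : u ∈ X ∩ G.nonneighbors x := ⟨hu.right_mem.1, mem_nonneighbors_comm.1 hv.left_mem.2⟩
    simp [hall x hx] at this
  push Not at hall
  obtain ⟨x₀, hx₀, c₀, hc₀⟩ := hall
  let F : Set (V × V) := {q | q.1 ∈ X ∧ q.2 ∈ X ∩ G.nonneighbors q.1}
  let comp : V × V → Set V := fun q => {w | G.ReachableIn (X ∩ G.nonneighbors q.1) q.2 w}
  -- `C` is a largest component among those left in `X` by deleting some closed neighbourhood, and
  -- `S` is its boundary in `X`.
  obtain ⟨⟨x, c⟩, ⟨hx, hc⟩, hmax⟩ := (Set.toFinite F).exists_maximalFor (fun q => (comp q).ncard) F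
    ⟨(x₀, c₀), hx₀, hc₀⟩
  dsimp only at hx hc
  let C := comp (x, c)
  have hCX : C ⊆ X ∩ G.nonneighbors x := fun w hw => ReachableIn.right_mem hw
  have hcC : c ∈ C := ReachableIn.refl hc
  let S : Set V := {s | s ∈ X ∧ s ∉ C ∧ ∃ d ∈ C, G.Adj d s}
  have hCconn : ∀ w ∈ C, G.ReachableIn C c w := by
    intro w hw
    refine (ReachableIn.inter_of_closed hw hcC ?_).mono Set.inter_subset_right
    exact fun a ha b hb hab => ReachableIn.trans ha (.of_adj hab (hCX ha) hb)
  -- If `y` missed some `s ∈ S`, then `C` together with `s` would survive deletion of the closed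
  -- neighbourhood of `y`, against maximality.
  have hS : ∀ y ∈ X, y ∉ C → y ∉ S → ∀ s ∈ S, G.Adj y s := by
    intro y hy hyC hyS s hs
    by_contra hys
    obtain ⟨hsX, hsC, d, hdC, hds⟩ := hs
    have hCy : C ⊆ X ∩ G.nonneighbors y := fun w hw =>
      ⟨(hCX hw).1, fun h => hyC (h ▸ hw), fun h => hyS ⟨hy, hyC, w, hw, h.symm⟩⟩
    have hsy : s ∈ X ∩ G.nonneighbors y :=
      ⟨hsX, fun h => hyS (h ▸ ⟨hsX, hsC, d, hdC, hds⟩), hys⟩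
    have hlt : C ⊂ comp (y, c) := by
      refine ⟨fun w hw => (hCconn w hw).mono hCy, fun hsub => hsC (hsub ?_)⟩
      exact ReachableIn.trans ((hCconn d hdC).mono hCy) (.of_adj hds (hCy hdC) hsy)
    have h1 := Set.ncard_lt_ncard hlt
    exact absurd (hmax (j := (y, c)) ⟨hy, hCy hcC⟩ h1.le) (not_le.2 h1)
  let X' : Set V := {v | v ∈ X ∧ v ∉ C ∧ v ∉ S}
  have hxX' : x ∈ X' := ⟨hx, fun h => (hCX h).2.1 rfl,
    fun ⟨_, _, d, hd, hdx⟩ => (hCX hd).2.2 hdx.symm⟩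
  have hlt : X'.ncard < X.ncard := Set.ncard_lt_ncard
    ⟨fun v hv => hv.1, fun hsub => (hsub hc.1).2.1 hcC⟩
  obtain ⟨y, hy, hadm⟩ := ih _ hlt X' ⟨x, hxX'⟩ rfl
  refine ⟨y, hy.1, fun u v hu hv => ?_⟩
  -- `S` separates `X'` from `C` in `X`, and every `v ∈ X'` is adjacent to all of `S`; a walk
  -- avoiding the neighbours of `v` therefore cannot leave `X'`.
  have memX' : ∀ {u v}, G.ReachableIn (X ∩ G.nonneighbors v) y u → v ∈ X' →
      G.ReachableIn (X' ∩ G.nonneighbors v) y u := by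
    intro u v hu hvX'
    refine (hu.inter_of_closed hy ?_).mono fun w hw => ⟨hw.2, hw.1.2⟩
    intro a ha b hb hab
    refine ⟨hb.1, fun hbC => ha.2.2 ⟨ha.1, ha.2.1, b, hbC, hab.symm⟩, fun hbS => ?_⟩
    exact hb.2.2 (hS v hvX'.1 hvX'.2.1 hvX'.2.2 b hbS)
  have notS : ∀ {u v}, G.ReachableIn (X ∩ G.nonneighbors u) y v → u ∉ S := fun hv huS =>
    hv.left_mem.2.2 (hS y hy.1 hy.2.1 hy.2.2 _ huS).symm
  by_cases huC : u ∈ C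
  · by_cases hvC : v ∈ C
    -- With `u` and `v` both in the connected set `C`, which misses the closed neighbourhood of `y`,
    -- the three vertices form an asteroidal triple.
    · have hCy : C ⊆ G.nonneighbors y := fun w hw =>
        ⟨fun h => hy.2.1 (h ▸ hw), fun h => hy.2.2 ⟨hy.1, hy.2.1, w, hw, h.symm⟩⟩
      exact h.false_of_reachableIn (hu.mono Set.inter_subset_right)
        (((hCconn u huC).symm.trans (hCconn v hvC)).mono hCy) (hv.mono Set.inter_subset_right)
    · exact (memX' hu ⟨hv.right_mem.1, hvC, notS hu⟩).right_mem.1.2.1 huC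
  · have huX' : u ∈ X' := ⟨hu.right_mem.1, huC, notS hv⟩
    have hv' := memX' hv huX'
    exact hadm u v (memX' hu hv'.right_mem.1) hv'

/-- An AT-free graph has a dominating pair. -/
theorem IsATFree.exists_dominating_pair [Finite V] [Nonempty V] (h : G.IsATFree) :
    ∃ x y, ∀ z, ¬ G.ReachableIn (G.nonneighbors z) x y := by
  obtain ⟨x, -, hx⟩ := h.exists_admissible Set.univ Set.univ_nonempty
  simp only [Set.univ_inter] at hx
  let D : V → Set V := fun v => {z | ¬ G.ReachableIn (G.nonneighbors z) x v}
  obtain ⟨y, hy⟩ := Finite.exists_max fun v => (D v).ncard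
  refine ⟨x, y, fun z hz => ?_⟩
  -- `D v` collects the vertices whose closed neighbourhoods meet every walk from `x` to `v`. If `w
  -- ∈ D y` were not in `D z`, the given walk to `y` could be diverted to `w`, contradicting
  -- admissibility of `x`. Strictness is witnessed by `z` itself.
  have hlt : D y ⊂ D z := by
    refine ⟨fun w hw hxz => ?_, fun hsub => hsub (a := z) (fun h => h.right_mem.1 rfl) hz⟩
    obtain ⟨p, hp⟩ := hz
    obtain ⟨d, hd, hdw⟩ : ∃ d ∈ p.support, d ∉ G.nonneighbors w := by
      by_contra! hcon
      exact hw ⟨p, hcon⟩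
    have hzw : w ∈ G.nonneighbors z := mem_nonneighbors_comm.1 hxz.right_mem
    have hxd : G.ReachableIn (G.nonneighbors z) x d := by
      classical
      exact ⟨p.takeUntil d hd, fun a ha => hp a (p.support_takeUntil_subset_support hd ha)⟩
    have hxw : G.ReachableIn (G.nonneighbors z) x w := by
      by_cases hdw' : d = w
      · exact hdw' ▸ hxd
      · have : G.Adj w d := by
          by_contra hn
          exact hdw ⟨hdw', hn⟩
        exact hxd.trans (.of_adj this.symm (hp d hd) hzw)
    exact hx w z hxw hxz
  exact absurd (hy z) (not_le.2 (Set.ncard_lt_ncard hlt))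

theorem IsATFree.rainbowConnectionNumber_le [Finite V] (hG : G.Connected)
    (hdeg : ∀ v, ∃ a b, a ≠ b ∧ G.Adj v a ∧ G.Adj v b) (h : G.IsATFree) :
    G.rainbowConnectionNumber ≤ (G.diam : ℕ∞) + 3 := by
  have := hG.nonempty
  obtain ⟨x, y, hxy⟩ := h.exists_dominating_pair
  obtain ⟨p, hp⟩ := hG.exists_walk_length_eq_dist x y
  have hpd : p.length ≤ G.diam := hp ▸ dist_le_diam (connected_iff_ediam_ne_top.1 hG)
  refine (rainbowConnectionNumber_le_of_dominating_walk hdeg p fun v hv => ?_).trans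
    (by gcongr)
  by_contra! hcon
  exact hxy v ⟨p, fun w hw => ⟨fun h => hv (h ▸ hw), hcon w hw⟩⟩

/-! ### Rainbow colourings of cycles -/

theorem exists_walk_of_forall_adj_succ {g : ℕ → V} (i l : ℕ)
    (hadj : ∀ t < l, G.Adj (g (i + t)) (g (i + t + 1))) :
    ∃ p : G.Walk (g i) (g (i + l)), (∀ w, w ∈ p.support ↔ ∃ t ≤ l, w = g (i + t)) ∧
      p.edges = (List.range l).map fun t => s(g (i + t), g (i + t + 1)) := by
  induction l with
  | zero => exact ⟨.nil, by simp, by simp⟩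
  | succ l ih =>
    obtain ⟨p, hp, hpe⟩ := ih fun t ht => hadj t (by omega)
    refine ⟨p.concat (hadj l (by omega)), fun w => ?_, ?_⟩
    · rw [Walk.support_concat, List.mem_append, List.mem_singleton, hp]
      constructor
      · rintro (⟨t, ht, rfl⟩ | rfl)
        · exact ⟨t, by omega, rfl⟩
        · exact ⟨l + 1, le_rfl, rfl⟩
      · rintro ⟨t, ht, rfl⟩
        rcases Nat.lt_or_ge l t with hlt | hge
        · exact Or.inr (by rw [show t = l + 1 by omega])
        · exact Or.inl ⟨t, hge, rfl⟩
    · simp [Walk.edges_concat, hpe, List.range_succ, Nat.add_assoc]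

theorem exists_rainbowOn_cycle {n : ℕ} (hn : 3 ≤ n) {g : ℕ → V} (hper : Function.Periodic g n)
    (hinj : ∀ i < n, ∀ j < n, g i = g j → i = j) (hadj : ∀ i, G.Adj (g i) (g (i + 1))) :
    ∃ c, G.RainbowOn (Set.range g) c ((n + 1) / 2) := by
  classical
  have hlt : ∀ i, i % n < n := fun i => Nat.mod_lt i (by omega)
  have hge : ∀ i, n ≤ i → i < 2 * n → i % n = i - n := fun i h h' => by
    rw [Nat.mod_eq_sub_mod h, Nat.mod_eq_of_lt (by omega)]
  have hmod : ∀ i j, g i = g j → i % n = j % n := fun i j h =>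
    hinj _ (hlt i) _ (hlt j) (by rwa [hper.map_mod_nat, hper.map_mod_nat])
  have hsucc : ∀ i, (i + 1) % n = if i % n + 1 = n then 0 else i % n + 1 := fun i => by
    have := hlt i
    rw [Nat.add_mod, Nat.mod_eq_of_lt (show 1 < n by omega)]
    split_ifs with h
    · rw [h, Nat.mod_self]
    · exact Nat.mod_eq_of_lt (by omega)
  have hedge : ∀ i j, s(g i, g (i + 1)) = s(g j, g (j + 1)) → i % n = j % n := by
    intro i j h
    rcases Sym2.eq_iff.1 h with ⟨h, -⟩ | ⟨h, h'⟩
    · exact hmod i j h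
    · have h1 := hmod _ _ h
      have h2 := hmod _ _ h'
      rw [hsucc] at h1 h2
      have := hlt i
      have := hlt j
      split_ifs at h1 h2 <;> omega
  obtain ⟨K, hK⟩ : ∃ K, K = (n + 1) / 2 := ⟨_, rfl⟩
  rw [← hK]
  have hK0 : 0 < K := by omega
  -- Positions along the cycle are coloured modulo `K`, half the length rounded up, so equal colours
  -- occur only at positions exactly `K` apart.
  let c : Sym2 V → ℕ := fun e =>
    if h : ∃ i, e = s(g i, g (i + 1)) then h.choose % n % K else 0
  have hc : ∀ i, c s(g i, g (i + 1)) = i % n % K := by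
    intro i
    have h : ∃ j, s(g i, g (i + 1)) = s(g j, g (j + 1)) := ⟨i, rfl⟩
    simp only [c]
    rw [dif_pos h, ← hedge i _ h.choose_spec]
  have hKmod : ∀ i j, j < i → i < j + 2 * K → i % K = j % K → i = j + K := by
    intro i j hji hij h
    obtain ⟨q, hq⟩ := (Nat.modEq_iff_dvd' hji.le).1 (show j ≡ i [MOD K] from h.symm)
    have hq1 : q = 1 := by
      rcases q with _ | _ | q
      · omega
      · rfl
      · have : K * 2 ≤ K * (q + 1 + 1) := Nat.mul_le_mul_left K (by omega)
        omega
    subst hq1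
    omega
  have walk : ∀ i l, (∀ s t, s < t → t < l → (i + s) % n % K ≠ (i + t) % n % K) →
      ∃ p : G.Walk (g i) (g (i + l)), (∀ w ∈ p.support, w ∈ Set.range g) ∧ p.IsRainbow c ∧
        ∀ e ∈ p.edges, c e < K := by
    intro i l hl
    obtain ⟨p, hp, hpe⟩ := exists_walk_of_forall_adj_succ i l fun t _ => hadj (i + t)
    refine ⟨p, fun w hw => ?_, ?_, ?_⟩
    · obtain ⟨t, -, rfl⟩ := (hp w).1 hw
      exact ⟨_, rfl⟩
    · rw [Walk.IsRainbow, hpe, List.map_map]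
      refine List.Nodup.map_on (fun s hs t ht h => ?_) List.nodup_range
      simp only [Function.comp_apply, hc] at h
      rw [List.mem_range] at hs ht
      rcases lt_trichotomy s t with hst | hst | hst
      · exact absurd h (hl s t hst ht)
      · exact hst
      · exact absurd h.symm (hl t s hst hs)
    · rw [hpe]
      simp only [List.mem_map]
      rintro _ ⟨t, -, rfl⟩
      rw [hc]
      exact Nat.mod_lt _ hK0
  have main : ∀ a b, a ≤ b → b < n → ∃ p : G.Walk (g a) (g b),
      (∀ w ∈ p.support, w ∈ Set.range g) ∧ p.IsRainbow c ∧ ∀ e ∈ p.edges, c e < K := by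
    intro a b hab hb
    by_cases h : b ≤ a + K
    · have := walk a (b - a) fun s t hst ht heq => by
        rw [Nat.mod_eq_of_lt (show a + s < n by omega),
          Nat.mod_eq_of_lt (show a + t < n by omega)] at heq
        have := hKmod (a + t) (a + s) (by omega) (by omega) heq.symm
        omega
      rwa [Nat.add_sub_cancel' hab] at this
    -- When the direct way has more than `K` edges, the way round through position `0` has fewer
    -- than `n - K`, too few to contain two edges of one colour.
    · have := walk b (a + n - b) fun s t hst ht heq => by
        by_cases hs : b + s < n
        · rw [Nat.mod_eq_of_lt hs] at heq
          by_cases ht' : b + t < n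
          · rw [Nat.mod_eq_of_lt ht'] at heq
            have := hKmod (b + t) (b + s) (by omega) (by omega) heq.symm
            omega
          · rw [hge (b + t) (by omega) (by omega)] at heq
            have := hKmod (b + s) (b + t - n) (by omega) (by omega) heq
            omega
        · rw [hge (b + s) (by omega) (by omega), hge (b + t) (by omega) (by omega)] at heq
          have := hKmod (b + t - n) (b + s - n) (by omega) (by omega) heq.symm
          omega
      rw [Nat.add_sub_cancel' (by omega), hper a] at this
      obtain ⟨p, hp, hpr, hpk⟩ := this
      refine ⟨p.reverse, by simpa using hp, ?_, by simpa using hpk⟩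
      rw [Walk.IsRainbow, Walk.edges_reverse, List.map_reverse]
      exact List.nodup_reverse.2 hpr
  refine ⟨c, ?_⟩
  rintro _ ⟨i, rfl⟩ _ ⟨j, rfl⟩
  rw [← hper.map_mod_nat i, ← hper.map_mod_nat j]
  rcases le_total (i % n) (j % n) with h | h
  · exact main _ _ h (hlt j)
  · obtain ⟨p, hp, hpr, hpk⟩ := main _ _ h (hlt i)
    refine ⟨p.reverse, by simpa using hp, ?_, by simpa using hpk⟩
    rw [Walk.IsRainbow, Walk.edges_reverse, List.map_reverse]
    exact List.nodup_reverse.2 hpr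

/-! ### Circular arc graphs -/

/-- `l v` and `r v` are the end points of closed arcs of the circle of length `1` that represent
the graph. -/
def IsArcModel (G : SimpleGraph V) (l r : V → ℝ) : Prop :=
  (∀ v, l v ≤ r v) ∧
    ∀ u v, u ≠ v → (G.Adj u v ↔ ∃ n : ℤ, l v + n ≤ r u ∧ l u ≤ r v + n)

theorem IsCircularArcGraph.exists_isArcModel [Finite V] (h : G.IsCircularArcGraph) :
    ∃ l r, G.IsArcModel l r := by
  classical
  have := Fintype.ofFinite V
  obtain ⟨s, hs, hadj⟩ := h
  choose I hI hsI using hs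
  have meet : ∀ u v, (s u ∩ s v).Nonempty ↔ ∃ x ∈ I u, ∃ n : ℤ, x - n ∈ I v := by
    intro u v
    rw [hsI u, hsI v]
    constructor
    · rintro ⟨_, ⟨x, hx, rfl⟩, ⟨y, hy, hxy⟩⟩
      obtain ⟨n, hn⟩ := AddCircle.coe_eq_zero_iff (1 : ℝ) |>.1
        (show ((x - y : ℝ) : UnitAddCircle) = 0 by
          rw [AddCircle.coe_sub]; exact sub_eq_zero.2 hxy.symm)
      refine ⟨x, hx, n, ?_⟩
      have : x - n = y := by
        simp only [zsmul_eq_mul, mul_one] at hn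
        linarith
      rwa [this]
    · rintro ⟨x, hx, n, hn⟩
      refine ⟨_, ⟨x, hx, rfl⟩, ⟨_, hn, ?_⟩⟩
      have : ((n : ℝ) : UnitAddCircle) = 0 :=
        (AddCircle.coe_eq_zero_iff (1 : ℝ)).2 ⟨n, by simp⟩
      simp [this]
  have pts : ∀ u v, ∃ x ∈ I u, ∃ y ∈ I v, (s u ∩ s v).Nonempty → ∃ n : ℤ, x - n = y := by
    intro u v
    by_cases huv : (s u ∩ s v).Nonempty
    · obtain ⟨x, hx, n, hn⟩ := (meet u v).1 huv
      exact ⟨x, hx, _, hn, fun _ => ⟨n, rfl⟩⟩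
    · obtain ⟨x, hx⟩ := (hI u).1
      obtain ⟨y, hy⟩ := (hI v).1
      exact ⟨x, hx, y, hy, fun h => absurd h huv⟩
  choose x hx y hy hxy using pts
  -- Finitely many witness points record all intersections; the closed interval they span in each `I
  -- u` loses none and creates none.
  let F : V → Finset ℝ := fun u => Finset.univ.image (x u) ∪ Finset.univ.image (y · u)
  have hxF : ∀ u v, x u v ∈ F u := fun u v => by simp [F]
  have hyF : ∀ u v, y u v ∈ F v := fun u v => by simp [F]
  have hFI : ∀ u, ∀ z ∈ F u, z ∈ I u := by
    intro u z hz
    simp only [F, Finset.mem_union, Finset.mem_image, Finset.mem_univ, true_and] at hz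
    rcases hz with ⟨v, rfl⟩ | ⟨v, rfl⟩
    · exact hx u v
    · exact hy v u
  have hne : ∀ u, (F u).Nonempty := fun u => ⟨_, hxF u u⟩
  have hle : ∀ u, (F u).min' (hne u) ≤ (F u).max' (hne u) := fun u =>
    (F u).min'_le_max' (hne u)
  have hmem : ∀ u z, (F u).min' (hne u) ≤ z → z ≤ (F u).max' (hne u) → z ∈ I u :=
    fun u z h1 h2 => (hI u).2.out (hFI u _ ((F u).min'_mem _)) (hFI u _ ((F u).max'_mem _)) ⟨h1, h2⟩
  refine ⟨fun u => (F u).min' (hne u), fun u => (F u).max' (hne u), hle, fun u v huv => ?_⟩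
  rw [hadj u v huv]
  constructor
  · intro h
    obtain ⟨n, hn⟩ := hxy u v h
    have h1 := (F u).min'_le _ (hxF u v)
    have h2 := (F u).le_max' _ (hxF u v)
    have h3 := (F v).min'_le _ (hyF u v)
    have h4 := (F v).le_max' _ (hyF u v)
    exact ⟨n, by linarith, by linarith⟩
  · rintro ⟨n, h1, h2⟩
    refine (meet u v).2 ⟨max ((F u).min' (hne u)) ((F v).min' (hne v) + n), ?_, n, ?_⟩
    · exact hmem u _ (le_max_left _ _) (max_le (hle u) h1)
    · refine hmem v _ (by linarith [le_max_right ((F u).min' (hne u)) ((F v).min' (hne v) + n)]) ?_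
      rw [sub_le_iff_le_add]
      exact max_le h2 (by linarith [hle v])

/-- No lifted arc crosses `t` to the right, so the circle can be cut just after `t`. Each arc has
one lift ending in `(t, t + 1]`, it starts after `t`, and only these lifts can meet one another. -/
theorem IsArcModel.isIntervalGraph_of_end {l r : V → ℝ} (h : G.IsArcModel l r) {t : ℝ}
    (ht : ∀ w, ∀ n : ℤ, l w + n ≤ t → r w + n ≤ t) : G.IsIntervalGraph := by
  have hsh : ∀ w, ∃ n : ℤ, t < r w + n ∧ r w + n ≤ t + 1 := by
    intro w
    refine ⟨⌊t + 1 - r w⌋, ?_, ?_⟩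
    · linarith [Int.lt_floor_add_one (t + 1 - r w)]
    · linarith [Int.floor_le (t + 1 - r w)]
  choose N hN hN' using hsh
  have hl : ∀ w, ∀ n : ℤ, t < r w + n → t < l w + n := fun w n hw => by
    by_contra! hcon
    exact absurd (ht w n hcon) (not_le.2 hw)
  refine ⟨fun w => Set.Icc (l w + N w) (r w + N w), fun w => ⟨?_, Set.ordConnected_Icc⟩, ?_⟩
  · exact Set.nonempty_Icc.2 (by linarith [h.1 w])
  · intro u v huv
    rw [h.2 u v huv]
    constructor
    · rintro ⟨n, h1, h2⟩
      have hNv : n + N u = N v := by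
        have h3 : t < r v + (n + N u : ℤ) := by
          push_cast
          linarith [hl u (N u) (hN u)]
        have h4 := hl v _ h3
        have h5 := hl v _ (hN v)
        rcases lt_trichotomy (n + N u) (N v) with hlt | heq | hgt
        · have : ((n + N u : ℤ) : ℝ) + 1 ≤ N v := by exact_mod_cast hlt
          linarith [hN' v]
        · exact heq
        · have : (N v : ℝ) + 1 ≤ ((n + N u : ℤ) : ℝ) := by exact_mod_cast hgt
          have h6 : l v + ((n + N u : ℤ) : ℝ) ≤ t + 1 := by
            push_cast
            linarith [hN' u]
          linarith
      have hNv' : (n : ℝ) + N u = N v := by exact_mod_cast hNv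
      refine ⟨max (l u + N u) (l v + N v), ⟨le_max_left _ _, max_le ?_ ?_⟩,
        ⟨le_max_right _ _, max_le ?_ ?_⟩⟩ <;> linarith [h.1 u, h.1 v]
    · rintro ⟨z, ⟨h1, h2⟩, ⟨h3, h4⟩⟩
      exact ⟨N v - N u, by push_cast; linarith, by push_cast; linarith⟩

/-- A greedy sequence of lifted arcs: each one reaches as far to the right as an arc meeting the
previous one can. -/
structure IsGreedySequence (l r : V → ℝ) (v : ℕ → V) (a : ℕ → ℤ) : Prop where
  left_le : ∀ i, l (v (i + 1)) + a (i + 1) ≤ r (v i) + a i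
  right_lt : ∀ i, r (v i) + a i < r (v (i + 1)) + a (i + 1)
  right_max : ∀ i w, ∀ n : ℤ, l w + n ≤ r (v i) + a i → r w + n ≤ r (v (i + 1)) + a (i + 1)

theorem exists_isGreedySequence [Finite V] {l r : V → ℝ}
    (hprog : ∀ v, ∃ w, ∃ n : ℤ, l w + n ≤ r v ∧ r v < r w + n) (v₀ : V) :
    ∃ v a, IsGreedySequence l r v a ∧ v 0 = v₀ ∧ a 0 = 0 := by
  have : Nonempty V := ⟨v₀⟩
  have step : ∀ s : V × ℤ, ∃ t : V × ℤ, l t.1 + t.2 ≤ r s.1 + s.2 ∧ r s.1 + s.2 < r t.1 + t.2 ∧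
      ∀ w, ∀ n : ℤ, l w + n ≤ r s.1 + s.2 → r w + n ≤ r t.1 + t.2 := by
    rintro ⟨u, b⟩
    -- The floor is the largest shift for which the lift of `w` still starts by the current right
    -- end.
    obtain ⟨t, ht⟩ := Finite.exists_max fun w => r w + ⌊r u + b - l w⌋
    have hmax : ∀ w, ∀ n : ℤ, l w + n ≤ r u + b → r w + n ≤ r t + ⌊r u + b - l t⌋ := by
      intro w n hn
      have : (n : ℝ) ≤ ⌊r u + b - l w⌋ := by
        exact_mod_cast Int.le_floor.2 (by linarith)
      linarith [ht w]
    refine ⟨(t, ⌊r u + b - l t⌋), by linarith [Int.floor_le (r u + b - l t)], ?_, hmax⟩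
    obtain ⟨w, n, h1, h2⟩ := hprog u
    have h3 := hmax w (n + b) (by push_cast; linarith)
    push_cast at h3
    dsimp only
    linarith
  choose nxt h1 h2 h3 using step
  let s : ℕ → V × ℤ := fun i => nxt^[i] (v₀, 0)
  have hs : ∀ i, s (i + 1) = nxt (s i) := fun i => Function.iterate_succ_apply' _ _ _
  refine ⟨fun i => (s i).1, fun i => (s i).2, ⟨fun i => ?_, fun i => ?_, fun i => ?_⟩, rfl, rfl⟩
  · rw [hs]; exact h1 _
  · rw [hs]; exact h2 _
  · rw [hs]; exact h3 _

namespace IsGreedySequence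

variable {l r : V → ℝ} {v : ℕ → V} {a : ℕ → ℤ}

theorem strictMono (h : IsGreedySequence l r v a) : StrictMono fun i => r (v i) + a i :=
  strictMono_nat_of_lt_succ h.right_lt

theorem exists_le_right [Finite V] (h : IsGreedySequence l r v a) :
    ∃ m, r (v 0) + a 0 + 1 ≤ r (v m) + a m := by
  -- A repeated vertex with a larger right end must have its integer shift raised by at least one
  -- full turn.
  obtain ⟨i, j, hij, hv⟩ := Finite.exists_ne_map_eq_of_infinite v
  wlog hlt : i < j generalizing i j
  · exact this j i hij.symm hv.symm (lt_of_le_of_ne (not_lt.1 hlt) hij.symm)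
  have h1 := h.strictMono hlt
  have h2 := h.strictMono.monotone (Nat.zero_le i)
  dsimp only at h1 h2
  rw [← hv] at h1
  have h3 : a i + 1 ≤ a j := by
    have : (a i : ℝ) < a j := by linarith
    exact_mod_cast this
  have h4 : (a i : ℝ) + 1 ≤ a j := by exact_mod_cast h3
  exact ⟨j, by rw [← hv]; linarith⟩

/-- How far lifts of a walk can reach. -/
theorem exists_shift (h : IsGreedySequence l r v a) (hG : G.IsArcModel l r) {u w : V}
    (p : G.Walk u w) : ∃ b : ℤ,
      (∀ (n : ℤ) i, r u + n ≤ r (v i) + a i →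
        r w + n + b ≤ r (v (i + p.length)) + a (i + p.length)) ∧
      ∀ (n : ℤ) i, r w + n ≤ r (v i) + a i →
        r u + n - b ≤ r (v (i + p.length)) + a (i + p.length) ∧
        (0 < p.length → l u + n - b ≤ r (v (i + p.length - 1)) + a (i + p.length - 1)) := by
  -- `b` is the total shift gained by lifting the walk. Each edge advances at most one greedy step;
  -- the last left end already lies within reach one step earlier.
  induction p with
  | nil => exact ⟨0, by simp, by simp⟩
  | @cons u u' w hu q ih =>
    obtain ⟨b, hb1, hb2⟩ := ih
    obtain ⟨n₀, h1, h2⟩ := (hG.2 u u' hu.ne).1 hu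
    refine ⟨n₀ + b, fun n i hn => ?_, fun n i hn => ?_⟩
    · have h3 := h.right_max i u' (n₀ + n) (by push_cast; linarith)
      have h4 := hb1 (n₀ + n) (i + 1) h3
      rw [Walk.length_cons, show i + (q.length + 1) = i + 1 + q.length by omega]
      push_cast at h4 ⊢
      linarith
    · have h3 := (hb2 n i hn).1
      have h4 : l u + ((n - n₀ - b : ℤ) : ℝ) ≤ r (v (i + q.length)) + a (i + q.length) := by
        push_cast
        linarith
      have h5 := h.right_max _ u _ h4
      rw [Walk.length_cons, show i + (q.length + 1) = i + q.length + 1 by omega]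
      simp only [Nat.add_sub_cancel]
      push_cast at h4 h5 ⊢
      exact ⟨by linarith, fun _ => by linarith⟩

theorem adj_succ (h : IsGreedySequence l r v a) (hG : G.IsArcModel l r) {i : ℕ}
    (hne : v i ≠ v (i + 1)) : G.Adj (v i) (v (i + 1)) := by
  refine (hG.2 _ _ hne).2 ⟨a (i + 1) - a i, ?_, ?_⟩ <;> push_cast
  · linarith [h.left_le i]
  · linarith [h.right_lt i, hG.1 (v i)]

end IsGreedySequence

theorem IsArcModel.rainbowConnectionNumber_le [Finite V] (hG : G.Connected) {l r : V → ℝ}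
    (hdeg : ∀ v, ∃ a b, a ≠ b ∧ G.Adj v a ∧ G.Adj v b) (h : G.IsArcModel l r)
    (hprog : ∀ v, ∃ w, ∃ n : ℤ, l w + n ≤ r v ∧ r v < r w + n) :
    G.rainbowConnectionNumber ≤ (G.diam : ℕ∞) + 4 := by
  classical
  have := hG.nonempty
  have htop := connected_iff_ediam_ne_top.1 hG
  -- Starting from a longest arc ensures that no later lift begins before `l (v 0)`, although its
  -- right end is further.
  obtain ⟨v₀, hv₀⟩ := Finite.exists_max fun v => r v - l v
  obtain ⟨v, a, hs, rfl, ha⟩ := exists_isGreedySequence hprog v₀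
  have hex : ∃ m, l (v 0) + 1 ≤ r (v m) + a m := by
    obtain ⟨m, hm⟩ := hs.exists_le_right
    rw [ha, Int.cast_zero] at hm
    exact ⟨m, by linarith [h.1 (v 0)]⟩
  obtain ⟨m, hm, hmin⟩ : ∃ m, l (v 0) + 1 ≤ r (v m) + a m ∧
      ∀ i < m, r (v i) + a i < l (v 0) + 1 :=
    ⟨Nat.find hex, Nat.find_spec hex, fun i hi => not_le.1 (Nat.find_min hex hi)⟩
  have hmono := hs.strictMono
  have hleft : ∀ i, l (v 0) ≤ l (v i) + a i := by
    intro i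
    have h1 := hmono.monotone (Nat.zero_le i)
    simp only [ha, Int.cast_zero] at h1
    linarith [hv₀ (v i)]
  -- A repetition would put the later left end at least one turn past `l (v 0)`, while it lies below
  -- the previous right end, which has not completed the turn.
  have hne : ∀ i j, i < j → j ≤ m → v i ≠ v j := by
    intro i j hij hj heq
    have h1 := hmono hij
    dsimp only at h1
    rw [heq] at h1
    have h2 : a i + 1 ≤ a j := by
      have : (a i : ℝ) < a j := by linarith
      exact_mod_cast this
    have h3 : (a i : ℝ) + 1 ≤ a j := by exact_mod_cast h2
    obtain ⟨j, rfl⟩ : ∃ k, j = k + 1 := ⟨j - 1, by omega⟩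
    have h4 := hleft i
    rw [heq] at h4
    linarith [hs.left_le j, hmin j (by omega)]
  have hadj : ∀ i < m, G.Adj (v i) (v (i + 1)) := fun i hi =>
    hs.adj_succ h (hne i (i + 1) (by omega) (by omega))
  have hdom : ∀ w, (∀ i ≤ m, w ≠ v i) → ∃ i ≤ m, G.Adj w (v i) := by
    intro w hw
    let n : ℤ := ⌈l (v 0) - l w⌉
    have hn1 : l (v 0) ≤ l w + n := by linarith [Int.le_ceil (l (v 0) - l w)]
    have hn2 : l w + n < l (v 0) + 1 := by linarith [Int.ceil_lt_add_one (l (v 0) - l w)]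
    have hex' : ∃ i, l w + n ≤ r (v i) + a i := ⟨m, by linarith⟩
    have hi := Nat.find_spec hex'
    have him : Nat.find hex' ≤ m := Nat.find_min' hex' (by linarith)
    have hlt : ∀ j < Nat.find hex', r (v j) + a j < l w + n := fun j hj =>
      not_le.1 (Nat.find_min hex' hj)
    generalize Nat.find hex' = i at hi him hlt
    have hli : l (v i) + a i ≤ l w + n := by
      rcases i with _ | i
      · rw [ha]
        simpa using hn1
      · linarith [hs.left_le i, hlt i (by omega)]
    refine ⟨i, him, (h.2 _ _ (hw i him)).2 ⟨a i - n, ?_, ?_⟩⟩ <;> push_cast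
    · linarith [h.1 w]
    · linarith
  -- A short sequence is a dominating walk of length at most `2 ≤ diam + 1`; otherwise it closes up
  -- to a cycle with at least four vertices.
  by_cases hm3 : m ≤ 2
  · obtain ⟨p, hp, hpe⟩ := exists_walk_of_forall_adj_succ (G := G) (g := v) 0 m
      (fun t ht => by simpa using hadj t ht)
    have hpl : p.length = m := by rw [← p.length_edges, hpe]; simp
    have hpm : ∀ i ≤ m, v i ∈ p.support := fun i hi => (hp _).2 ⟨i, hi, by simp⟩
    have hd1 : 1 ≤ G.diam := by
      have : Nontrivial V := by
        obtain ⟨x, -, -, hx, -⟩ := hdeg (v 0)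
        exact ⟨_, _, hx.ne⟩
      exact Nat.one_le_iff_ne_zero.2 (diam_ne_zero_of_ediam_ne_top htop)
    refine (rainbowConnectionNumber_le_of_dominating_walk hdeg p fun w hw => ?_).trans ?_
    · obtain ⟨i, hi, hwi⟩ := hdom w fun i hi heq => hw (heq ▸ hpm i hi)
      exact ⟨v i, hpm i hi, hwi⟩
    · norm_cast
      omega
  · have hclose : G.Adj (v m) (v 0) := by
      refine (h.2 _ _ (hne 0 m (by omega) le_rfl).symm).2 ⟨1 - a m, ?_, ?_⟩ <;> push_cast
      · linarith
      · obtain ⟨k, rfl⟩ : ∃ k, m = k + 1 := ⟨m - 1, by omega⟩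
        linarith [hs.left_le k, hmin k (by omega), h.1 (v 0)]
    let g : ℕ → V := fun i => v (i % (m + 1))
    have hg : ∀ i ≤ m, g i = v i := fun i hi => by
      simp only [g]
      rw [Nat.mod_eq_of_lt (by omega)]
    have hper : Function.Periodic g (m + 1) := fun i => by simp [g]
    obtain ⟨c, hc⟩ := exists_rainbowOn_cycle (G := G) (n := m + 1) (by omega) hper
      (fun i hi j hj hij => by
        rw [hg i (by omega), hg j (by omega)] at hij
        rcases lt_trichotomy i j with hlt | heq | hgt
        · exact absurd hij (hne i j hlt (by omega))
        · exact heq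
        · exact absurd hij.symm (hne j i hgt (by omega)))
      (fun i => by
        have hi : i % (m + 1) < m + 1 := Nat.mod_lt _ (by omega)
        have h1 : g (i + 1) = g (i % (m + 1) + 1) := by simp [g]
        rw [h1, ← hper.map_mod_nat i, hg _ (by omega)]
        rcases Nat.lt_or_ge (i % (m + 1)) m with hlt | hge
        · rw [hg _ (by omega)]
          exact hadj _ hlt
        · have : i % (m + 1) = m := by omega
          rw [this]
          simpa [g] using hclose)
    -- A walk from `v 0` to the opposite vertex `v k` winds one way or the other. No walk outruns
    -- the greedy sequence, so it has at least `k` or at least `m + 1 - k` edges. The cycle then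
    -- needs at most `diam + 1` colours, rounding up included.
    have hdiam : (m + 1) / 2 ≤ G.diam := by
      obtain ⟨k, hk⟩ : ∃ k, k = (m + 1) / 2 := ⟨_, rfl⟩
      rw [← hk]
      obtain ⟨p, hp⟩ := hG.exists_walk_length_eq_dist (v 0) (v k)
      have hpd : p.length ≤ G.diam := hp ▸ dist_le_diam htop
      obtain ⟨b, hb1, hb2⟩ := hs.exists_shift h p
      have hp0 : 0 < p.length := by
        rw [hp]
        exact hG.pos_dist_of_ne (hne 0 k (by omega) (by omega))
      by_cases hbk : a k ≤ b
      · have h1 := hb1 0 0 (by simp [ha])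
        have h2 : (a k : ℝ) ≤ b := by exact_mod_cast hbk
        have h3 : r (v k) + a k ≤ r (v (0 + p.length)) + a (0 + p.length) := by
          push_cast at h1
          linarith
        have := hmono.le_iff_le.1 h3
        omega
      · have h1 := (hb2 (a k) k le_rfl).2 hp0
        have h2 : (b : ℝ) + 1 ≤ a k := by exact_mod_cast not_le.1 hbk
        have h3 : m ≤ k + p.length - 1 := by
          by_contra! hlt
          linarith [hmin _ hlt]
        omega
    have hmem : ∀ i ≤ m, v i ∈ Set.range g := fun i hi => ⟨i, hg i hi⟩
    refine (rainbowConnectionNumber_le_add_three hdeg (fun w hw => ?_) hc).trans ?_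
    · obtain ⟨i, hi, hwi⟩ := hdom w fun i hi heq => hw (heq ▸ hmem i hi)
      exact ⟨v i, hmem i hi, hwi⟩
    · norm_cast
      omega

theorem IsCircularArcGraph.rainbowConnectionNumber_le [Finite V] (hG : G.Connected)
    (hdeg : ∀ v, ∃ a b, a ≠ b ∧ G.Adj v a ∧ G.Adj v b) (h : G.IsCircularArcGraph) :
    G.rainbowConnectionNumber ≤ (G.diam : ℕ∞) + 4 := by
  obtain ⟨l, r, h⟩ := h.exists_isArcModel
  -- If some arc cannot be continued to the right, its right end is a place to cut the circle.
  by_cases hprog : ∀ v, ∃ w, ∃ n : ℤ, l w + n ≤ r v ∧ r v < r w + n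
  · exact h.rainbowConnectionNumber_le hG hdeg hprog
  · push Not at hprog
    obtain ⟨v, hv⟩ := hprog
    refine ((h.isIntervalGraph_of_end hv).rainbowConnectionNumber_le hG hdeg).trans ?_
    gcongr
    norm_num

/-! ### Extremal examples -/

/-- If the short paths between the vertices of `T` all pass through one of two common neighbours
`a`, `b` of `T`, then `q` colours do not suffice as soon as `T` has more than `q ^ 2` vertices. -/
theorem lt_rainbowConnectionNumber_of_two_common_neighbors {V : Type*} {G : SimpleGraph V}
    {q : ℕ} {a b : V} {T : Finset V} (hT : q * q < T.card) (ha : ∀ t ∈ T, G.Adj t a)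
    (hb : ∀ t ∈ T, G.Adj t b)
    (hpath : ∀ t ∈ T, ∀ t' ∈ T, t ≠ t' → ∀ p : G.Walk t t', p.length ≤ q →
      ∃ x, (x = a ∨ x = b) ∧ s(t, x) ∈ p.edges ∧ s(x, t') ∈ p.edges) :
    (q : ℕ∞) + 1 ≤ G.rainbowConnectionNumber := by
  classical
  refine le_iInf₂ fun c hc => ?_
  by_contra! hlt
  have hle : (Set.range c).encard ≤ q := by
    rwa [ENat.lt_add_one_iff (by simp)] at hlt
  have hfin : (Set.range c).Finite := Set.finite_of_encard_le_coe hle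
  have hcard : hfin.toFinset.card ≤ q := by
    rw [hfin.encard_eq_coe_toFinset_card] at hle
    exact_mod_cast hle
  -- `f` records the colours of the edges to `a` and `b`. With at most `q` colours two vertices of
  -- `T` agree, and every rainbow path between them repeats a colour at `a` or `b`. The default `(0,
  -- 0)` is never taken on `T`.
  let f : V → ℕ × ℕ := fun t =>
    if h : G.Adj t a ∧ G.Adj t b then (c ⟨s(t, a), h.1⟩, c ⟨s(t, b), h.2⟩) else (0, 0)
  have hf : ∀ t (hta : G.Adj t a) (htb : G.Adj t b),
      f t = (c ⟨s(t, a), hta⟩, c ⟨s(t, b), htb⟩) := fun t hta htb => dif_pos ⟨hta, htb⟩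
  obtain ⟨t, ht, t', ht', hne, heq⟩ := Finset.exists_ne_map_eq_of_card_lt_of_maps_to
    (s := T) (t := hfin.toFinset ×ˢ hfin.toFinset) (f := f)
    (by rw [Finset.card_product]; exact (Nat.mul_le_mul hcard hcard).trans_lt hT)
    (fun t ht => by
      have ht : t ∈ T := ht
      rw [hf t (ha t ht) (hb t ht)]
      simp)
  rw [hf t (ha t ht) (hb t ht), hf t' (ha t' ht') (hb t' ht'), Prod.mk.injEq] at heq
  obtain ⟨p, hp⟩ := hc t t'
  have hpq : p.length ≤ q := by exact_mod_cast hp.length_le_encard.trans hle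
  obtain ⟨x, hx, h1, h2⟩ := hpath t ht t' ht' hne p hpq
  have h2' : s(t', x) ∈ p.edges := by rwa [Sym2.eq_swap]
  have : s(t, x) = s(t', x) := by
    rcases hx with rfl | rfl
    · exact congrArg Subtype.val (hp.2 ⟨_, ha t ht⟩ ⟨_, ha t' ht'⟩ h1 h2' heq.1)
    · exact congrArg Subtype.val (hp.2 ⟨_, hb t ht⟩ ⟨_, hb t' ht'⟩ h1 h2' heq.2)
  exact hne (Sym2.congr_left.1 this)

theorem diam_eq_two {V : Type*} [Finite V] {G : SimpleGraph V} (hG : G.Connected)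
    (h2 : ∀ u v, G.dist u v ≤ 2) {u v : V} (hne : u ≠ v) (huv : ¬ G.Adj u v) : G.diam = 2 := by
  have := hG.nonempty
  obtain ⟨x, y, hxy⟩ := G.exists_dist_eq_diam
  have h1 : G.dist u v ≤ G.diam := dist_le_diam (connected_iff_ediam_ne_top.1 hG)
  have h3 := hG.pos_dist_of_ne hne
  have h4 : G.dist u v ≠ 1 := fun h => huv (dist_eq_one_iff_adj.1 h)
  have := h2 x y
  omega

theorem dist_le_two {V : Type*} {G : SimpleGraph V} {u v w : V} (h : G.Adj u w)
    (h' : G.Adj w v) : G.dist u v ≤ 2 :=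
  dist_le (.cons h h'.toWalk)

theorem two_le_minDegree {V : Type*} [Fintype V] [Nonempty V] {G : SimpleGraph V}
    [DecidableRel G.Adj] (h : ∀ v, ∃ a b, a ≠ b ∧ G.Adj v a ∧ G.Adj v b) : 2 ≤ G.minDegree := by
  refine G.le_minDegree_of_forall_le_degree 2 fun v => ?_
  obtain ⟨a, b, hab, ha, hb⟩ := h v
  exact Finset.one_lt_card.2 ⟨a, by simpa using ha, b, by simpa using hb, hab⟩

/-- The join of `K₂` and five isolated vertices. -/
def twoJoinFive : SimpleGraph (Fin 7) where
  Adj u v := u ≠ v ∧ (u < 2 ∨ v < 2)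
  symm := ⟨fun _ _ h => ⟨h.1.symm, h.2.symm⟩⟩
  loopless := ⟨fun _ h => h.1 rfl⟩

instance : DecidableRel twoJoinFive.Adj := fun u v =>
  inferInstanceAs (Decidable (u ≠ v ∧ (u < 2 ∨ v < 2)))

namespace twoJoinFive

theorem exists_two_adj (v : Fin 7) :
    ∃ a b, a ≠ b ∧ twoJoinFive.Adj v a ∧ twoJoinFive.Adj v b := by
  revert v
  decide

theorem connected : twoJoinFive.Connected := by
  have h : ∀ v, twoJoinFive.Reachable 0 v := fun v => by
    by_cases hv : v = 0
    · rw [hv]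
    · exact Adj.reachable ⟨Ne.symm hv, Or.inl (by decide)⟩
  exact (connected_iff _).2 ⟨fun u v => (h u).symm.trans (h v), ⟨0⟩⟩

theorem isThresholdGraph : twoJoinFive.IsThresholdGraph := by
  refine ⟨fun v => if v < 2 then 1 else 0, 1, fun u v huv => ?_⟩
  by_cases hu : u < 2 <;> by_cases hv : v < 2 <;> simp [twoJoinFive, huv, hu, hv]

theorem isIntervalGraph : twoJoinFive.IsIntervalGraph := by
  refine ⟨fun v => if v < 2 then Set.univ else {(v : ℝ)}, fun v => ?_, fun u v huv => ?_⟩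
  · dsimp only
    split_ifs
    · exact ⟨Set.univ_nonempty, Set.ordConnected_univ⟩
    · exact ⟨Set.singleton_nonempty _, Set.ordConnected_singleton⟩
  · have : (u : ℕ) ≠ v := fun h => huv (Fin.ext h)
    by_cases hu : u < 2 <;> by_cases hv : v < 2 <;>
      simp [twoJoinFive, huv, hu, hv, this.symm]

theorem diam_eq : twoJoinFive.diam = 2 := by
  refine diam_eq_two connected (fun u v => ?_) (u := 2) (v := 3) (by decide) (by decide)
  by_cases hu : u = 0
  · by_cases hv : v = 0
    · simp [hu, hv]
    · exact (dist_eq_one_iff_adj.2 (show twoJoinFive.Adj u v from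
        ⟨fun h => hv (h ▸ hu), Or.inl (by simp [hu])⟩)).le.trans (by norm_num)
  · by_cases hv : v = 0
    · exact (dist_eq_one_iff_adj.2 (show twoJoinFive.Adj u v from
        ⟨fun h => hu (h ▸ hv), Or.inr (by simp [hv])⟩)).le.trans (by norm_num)
    · exact dist_le_two (w := 0) ⟨hu, Or.inr (by decide)⟩ ⟨Ne.symm hv, Or.inl (by decide)⟩

theorem rainbowConnectionNumber_eq : twoJoinFive.rainbowConnectionNumber = 3 := by
  refine le_antisymm (isThresholdGraph.rainbowConnectionNumber_le exists_two_adj) ?_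
  have := lt_rainbowConnectionNumber_of_two_common_neighbors (G := twoJoinFive) (q := 2)
    (a := 0) (b := 1) (T := {2, 3, 4, 5, 6}) (by decide) (by decide) (by decide) ?_
  · exact le_of_eq_of_le (by norm_num) this
  · intro t ht t' ht' hne p hp
    have hind : ∀ t ∈ ({2, 3, 4, 5, 6} : Finset (Fin 7)),
        ∀ t' ∈ ({2, 3, 4, 5, 6} : Finset (Fin 7)), ¬ twoJoinFive.Adj t t' := by decide
    have hnbr : ∀ t ∈ ({2, 3, 4, 5, 6} : Finset (Fin 7)), ∀ x, twoJoinFive.Adj t x →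
        x = 0 ∨ x = 1 := by decide
    match p, hp with
    | .nil, _ => exact absurd rfl hne
    | .cons h .nil, _ => exact absurd h (hind _ ht _ ht')
    | .cons (v := x) h (.cons h' .nil), _ => exact ⟨x, hnbr t ht x h, by simp, by simp⟩
    | .cons _ (.cons _ (.cons _ q)), hp =>
      simp only [Walk.length_cons] at hp
      omega

end twoJoinFive

/-- The complete bipartite graph `K_{2,10}`. -/
def twoTen : SimpleGraph (Fin 12) where
  Adj u v := ¬ (u < 2 ↔ v < 2)
  symm := ⟨fun _ _ h => fun h' => h h'.symm⟩
  loopless := ⟨fun _ h => h Iff.rfl⟩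

instance : DecidableRel twoTen.Adj := fun u v =>
  inferInstanceAs (Decidable (¬ (u < 2 ↔ v < 2)))

namespace twoTen

theorem exists_two_adj (v : Fin 12) : ∃ a b, a ≠ b ∧ twoTen.Adj v a ∧ twoTen.Adj v b := by
  revert v
  decide

theorem dist_le_two (u v : Fin 12) : twoTen.dist u v ≤ 2 := by
  by_cases huv : twoTen.Adj u v
  · exact (dist_eq_one_iff_adj.2 huv).le.trans (by norm_num)
  · obtain ⟨w, -, -, hw, -⟩ := exists_two_adj u
    refine SimpleGraph.dist_le_two hw ?_
    simp only [twoTen] at hw huv ⊢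
    tauto

theorem connected : twoTen.Connected := by
  refine (connected_iff _).2 ⟨fun u v => ?_, ⟨0⟩⟩
  by_cases huv : twoTen.Adj u v
  · exact huv.reachable
  · obtain ⟨w, -, -, hw, -⟩ := exists_two_adj u
    have hwv : twoTen.Adj w v := by
      simp only [twoTen] at hw huv ⊢
      tauto
    exact hw.reachable.trans hwv.reachable

theorem isChainGraph : twoTen.IsChainGraph := by
  refine ⟨{v | v < 2}, {v | ¬ v < 2}, ?_, ⟨?_, ?_⟩, 2, ![0, 1], by decide, ?_, ?_⟩
  · ext v
    simp [lt_or_ge]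
  · exact Set.disjoint_left.2 fun v h h' => h' h
  · intro u v huv
    have : ¬ (u < 2 ↔ v < 2) := huv
    show (u < 2 ∧ ¬ v < 2) ∨ (¬ u < 2 ∧ v < 2)
    tauto
  · ext v
    simp only [Set.mem_range]
    show _ ↔ v < 2
    revert v
    decide
  · intro i j _ v hv
    have key : ∀ i j : Fin 2, ∀ v, twoTen.Adj (![0, 1] i) v → twoTen.Adj (![0, 1] j) v := by
      decide
    exact key i j v hv

/-- Non-adjacent vertices lie on one side, so the second vertex of any path from `x` is a neighbour
of `z`. -/
theorem isATFree : twoTen.IsATFree := by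
  rintro x y z ⟨⟨hxy, -, -⟩, ⟨-, -, h3⟩, ⟨p, -, hp⟩, -, -⟩
  cases p with
  | nil => exact hxy rfl
  | @cons _ w _ h q =>
    refine hp w (by simp) ?_
    simp only [twoTen] at h h3 ⊢
    grind

theorem diam_eq : twoTen.diam = 2 :=
  diam_eq_two connected dist_le_two (u := 2) (v := 3) (by decide) (by decide)

theorem rainbowConnectionNumber_eq : twoTen.rainbowConnectionNumber = 4 := by
  refine le_antisymm (isChainGraph.rainbowConnectionNumber_le exists_two_adj) ?_
  have hT : ∀ t, t ∈ Finset.univ.filter (fun t : Fin 12 => ¬ t < 2) ↔ ¬ t < 2 := by simp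
  have := lt_rainbowConnectionNumber_of_two_common_neighbors (G := twoTen) (q := 3)
    (a := 0) (b := 1) (T := Finset.univ.filter fun t => ¬ t < 2) (by decide)
    (by decide) (by decide) ?_
  · exact le_of_eq_of_le (by norm_num) this
  · intro t ht t' ht' hne p hp
    rw [hT] at ht ht'
    have hnbr : ∀ x : Fin 12, x < 2 → x = 0 ∨ x = 1 := by decide
    match p, hp with
    | .nil, _ => exact absurd rfl hne
    | .cons h .nil, _ => exact absurd (iff_of_false ht ht') h
    | .cons (v := x) h (.cons h' .nil), _ =>
      refine ⟨x, hnbr x ?_, by simp, by simp⟩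
      simp only [twoTen] at h
      grind
    -- Walks of odd length change sides, so `q = 3` is allowed and ten vertices exceed `3 * 3`.
    | .cons h (.cons h' (.cons h'' .nil)), _ =>
      exfalso
      simp only [twoTen] at h h' h''
      grind
    | .cons _ (.cons _ (.cons _ (.cons _ q))), hp =>
      simp only [Walk.length_cons] at hp
      omega

end twoTen

end SimpleGraph

theorem mainTheorem5 :
    (∀ (V : Type*) [Fintype V] (G : SimpleGraph V) [DecidableRel G.Adj],
      G.Connected → 2 ≤ G.minDegree →
        (G.IsIntervalGraph →
          (G.diam : ℕ∞) ≤ G.rainbowConnectionNumber ∧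
            G.rainbowConnectionNumber ≤ (G.diam : ℕ∞) + 1) ∧
        (G.IsATFree →
          (G.diam : ℕ∞) ≤ G.rainbowConnectionNumber ∧
            G.rainbowConnectionNumber ≤ (G.diam : ℕ∞) + 3) ∧
        (G.IsThresholdGraph →
          (G.diam : ℕ∞) ≤ G.rainbowConnectionNumber ∧ G.rainbowConnectionNumber ≤ 3) ∧
        (G.IsChainGraph →
          (G.diam : ℕ∞) ≤ G.rainbowConnectionNumber ∧ G.rainbowConnectionNumber ≤ 4) ∧
        (G.IsCircularArcGraph →
          (G.diam : ℕ∞) ≤ G.rainbowConnectionNumber ∧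
            G.rainbowConnectionNumber ≤ (G.diam : ℕ∞) + 4)) ∧
    (∃ (n : ℕ) (G : SimpleGraph (Fin n)) (_ : DecidableRel G.Adj),
      G.Connected ∧ 2 ≤ G.minDegree ∧ G.IsIntervalGraph ∧
        G.rainbowConnectionNumber = (G.diam : ℕ∞) + 1) ∧
    (∃ (n : ℕ) (G : SimpleGraph (Fin n)) (_ : DecidableRel G.Adj),
      G.Connected ∧ 2 ≤ G.minDegree ∧ G.IsThresholdGraph ∧
        G.rainbowConnectionNumber = 3) ∧
    (∃ (n : ℕ) (G : SimpleGraph (Fin n)) (_ : DecidableRel G.Adj),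
      G.Connected ∧ 2 ≤ G.minDegree ∧ G.IsChainGraph ∧
        G.rainbowConnectionNumber = 4) ∧
    (∃ (n : ℕ) (G : SimpleGraph (Fin n)) (_ : DecidableRel G.Adj),
      G.Connected ∧ 2 ≤ G.minDegree ∧ G.IsATFree ∧
        G.rainbowConnectionNumber = (G.diam : ℕ∞) + 2) := by
  refine ⟨fun V _ G _ hG hδ => ?_, ?_, ?_, ?_, ?_⟩
  · have := hG.nonempty
    have hdeg := SimpleGraph.exists_two_adj_of_two_le_minDegree hδ
    have hle := G.diam_le_rainbowConnectionNumber
    exact ⟨fun h => ⟨hle, h.rainbowConnectionNumber_le hG hdeg⟩,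
      fun h => ⟨hle, h.rainbowConnectionNumber_le hG hdeg⟩,
      fun h => ⟨hle, h.rainbowConnectionNumber_le hdeg⟩,
      fun h => ⟨hle, h.rainbowConnectionNumber_le hdeg⟩,
      fun h => ⟨hle, h.rainbowConnectionNumber_le hG hdeg⟩⟩
  · refine ⟨7, .twoJoinFive, inferInstance, SimpleGraph.twoJoinFive.connected,
      SimpleGraph.two_le_minDegree SimpleGraph.twoJoinFive.exists_two_adj,
      SimpleGraph.twoJoinFive.isIntervalGraph, ?_⟩
    rw [SimpleGraph.twoJoinFive.rainbowConnectionNumber_eq, SimpleGraph.twoJoinFive.diam_eq]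
    norm_num
  · exact ⟨7, .twoJoinFive, inferInstance, SimpleGraph.twoJoinFive.connected,
      SimpleGraph.two_le_minDegree SimpleGraph.twoJoinFive.exists_two_adj,
      SimpleGraph.twoJoinFive.isThresholdGraph, SimpleGraph.twoJoinFive.rainbowConnectionNumber_eq⟩
  · exact ⟨12, .twoTen, inferInstance, SimpleGraph.twoTen.connected,
      SimpleGraph.two_le_minDegree SimpleGraph.twoTen.exists_two_adj,
      SimpleGraph.twoTen.isChainGraph, SimpleGraph.twoTen.rainbowConnectionNumber_eq⟩
  · refine ⟨12, .twoTen, inferInstance, SimpleGraph.twoTen.connected,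
      SimpleGraph.two_le_minDegree SimpleGraph.twoTen.exists_two_adj,
      SimpleGraph.twoTen.isATFree, ?_⟩
    rw [SimpleGraph.twoTen.rainbowConnectionNumber_eq, SimpleGraph.twoTen.diam_eq]
    norm_num
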